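/- Let $K\ge 2$, and for $a=1,\dots,K$ let $n_a\ge 1$ and let $x_a:M^{n_a}\to\mathbb R^{n_a+1}$ be a hyperbolic affine hypersphere with affine mean curvature $L_1^{(a)}<0$, affine metric $g^{(a)}$ and the origin as affine center. (Here hypersurfaces are smooth, immersed and nondegenerate; "hyperbolic affine hypersphere with affine mean curvature $L_1$" means that the affine shape operator is $L_1\cdot\mathrm{id}$ for a negative constant $L_1$, where the affine metric and the affine normal, which are determined up to a common sign, are chosen so that the affine metric is nowhere negative definite.) Put $$f_a=n_1+\dots+n_a+a,\qquad n=f_K-1,\qquad e_a(t)=\exp\Big(-\frac{t_{a-1}}{n_a+1}+\sum_{\lambda=a}^{K-1}\frac{t_\lambda}{f_\lambda}\Big)\quad (t\in\mathbb R^{K-1}),$$ where the term with $t_{a-1}$ is absent for $a=1$. (1) For all positive numbers $c_1,\dots,c_K$ the map $$x=(c_1e_1x_1,\dots,c_Ke_Kx_K):\ \mathbb R^{K-1}\times M^{n_1}\times\dots\times M^{n_K}\to\mathbb R^{n+1},\qquad x(t,p_1,\dots,p_K)=(c_1e_1(t)x_1(p_1),\dots,c_Ke_K(t)x_K(p_K)),$$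 is a hyperbolic affine hypersphere with the origin as affine center and with affine mean curvature $$L_1=-\frac{1}{f_K\,C},\qquad C:=\left(\frac1{f_K}\prod_{a=1}^K\frac{c_a^{2(n_a+1)}}{(n_a+1)^{n_a+1}\,(-L_1^{(a)})^{n_a+2}}\right)^{\frac1{n+2}},$$ and its affine metric is $$g=\sum_{\lambda=1}^{K-1}\frac{f_{\lambda+1}\,C}{(n_{\lambda+1}+1)\,f_\lambda}\,(dt_\lambda)^2+\sum_{a=1}^K (n_a+1)\,(-L_1^{(a)})\,C\;g^{(a)}.$$ (2) For all positive numbers $c_1,\dots,c_K$ there exist $c>0$ and $c'>0$ such that the three hyperbolic affine hyperspheres $$x=(c_1e_1x_1,\dots,c_Ke_Kx_K),\quad \bar x=c\,(e_1x_1,\dots,e_Kx_K),\quad \tilde x=(e_1x_1,\dots,e_{K-1}x_{K-1},c'e_Kx_K)$$ are pairwise equiaffinely equivalent, that is, any two of them differ by an affine transformation of $\mathbb R^{n+1}$ of determinant $1$. -/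

import Mathlib

open scoped Manifold ContDiff

noncomputable section

section Hypersurface

variable {E : Type*} [NormedAddCommGroup E] [NormedSpace ℝ E]
  {H : Type*} [TopologicalSpace H] (I : ModelWithCorners ℝ E H)
  {M : Type*} [TopologicalSpace M] [ChartedSpace H M]
  {ι : Type*} [Fintype ι] [DecidableEq ι]

/-- The differential `dx_p : T_p M → ℝ^ι`. -/
def differential (x : M → ι → ℝ) (p : M) : TangentSpace I p →ₗ[ℝ] (ι → ℝ) where
  toFun v := mfderiv I 𝓘(ℝ, ι → ℝ) x p v
  map_add' := map_add (mfderiv I 𝓘(ℝ, ι → ℝ) x p)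
  map_smul' := map_smul (mfderiv I 𝓘(ℝ, ι → ℝ) x p)

/-- The second derivative at `p` of a map `x : M → ℝ^ι`, computed in the
preferred chart at `p` (the chart through which Mathlib identifies `T_p M` with the model space).
Its class modulo `dx (T_p M)` does not depend on the chart. -/
def chartHessian (x : M → ι → ℝ) (p : M) (v w : TangentSpace I p) : ι → ℝ :=
  fderiv ℝ (fderiv ℝ (x ∘ (extChartAt I p).symm)) (extChartAt I p p) v w

/-- `x : M → ℝ^ι` is a nondegenerate immersed hypersurface of the equiaffine space `ℝ^ι`
(with the standard volume form `det`) of a manifold `M` without boundary; `g` is its affine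
(Berwald–Blaschke) metric, `ξ` its affine normal and `B` its affine shape operator.

The pair `(g, ξ)` is characterised, up to a common sign (the choice of a co-orientation), as
follows: `ξ` is transversal, `g` is the second fundamental form relative to `ξ` (`gauss`), the
derivative of `ξ` is tangential (`weingarten`), and the volume form `det (dx ·, …, dx ·, ξ)`
induced on `M` is, up to sign, that of the metric `g` (`volume_eq`). This is the standard definition
of the affine normal of a nondegenerate hypersurface. In local coordinates, `gauss` and `volume_eq`
say that `g_{ij} = ± H^{-1/(n+2)} h_{ij}`, where `h_{ij} = det (∂₁x, …, ∂ₙx, ∂ᵢ∂ⱼx)` and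
`H = |det (h_{ij})|`, and `ξ` is `(1/n) Δ_g x`. -/
structure IsBlaschkeHypersurface (x : M → ι → ℝ)
    (g : ∀ p : M, LinearMap.BilinForm ℝ (TangentSpace I p)) (ξ : M → ι → ℝ)
    (B : ∀ p : M, TangentSpace I p →ₗ[ℝ] TangentSpace I p) : Prop where
  codim_one : Fintype.card ι = Module.finrank ℝ E + 1
  smooth : ContMDiff I 𝓘(ℝ, ι → ℝ) ∞ x
  immersion : ∀ p, Function.Injective (differential I x p)
  smooth_normal : ContMDiff I 𝓘(ℝ, ι → ℝ) ∞ ξ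
  transversal : ∀ p, ∀ v : TangentSpace I p, differential I x p v ≠ ξ p
  nondegenerate : ∀ p, (g p).Nondegenerate
  gauss : ∀ p, ∀ v w : TangentSpace I p, ∃ z : TangentSpace I p,
    chartHessian I x p v w = differential I x p z + g p v w • ξ p
  weingarten : ∀ p, ∀ v : TangentSpace I p,
    differential I ξ p v = -differential I x p (B p v)
  volume_eq : ∀ p, ∀ {κ : Type} [Fintype κ] [DecidableEq κ] (σ : ι ≃ Option κ)
    (X : κ → TangentSpace I p),
    |(Matrix.of fun i : ι =>
        (σ i).elim (ξ p) fun j => differential I x p (X j)).det| =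
      √|(Matrix.of fun j l : κ => g p (X j) (X l)).det|

/-- The affine mean curvature `L₁ = (1/n) tr B` belonging to an affine shape operator `B`. -/
def affineMeanCurvature (B : ∀ p : M, TangentSpace I p →ₗ[ℝ] TangentSpace I p) (p : M) : ℝ :=
  LinearMap.trace ℝ (TangentSpace I p) (B p) / Module.finrank ℝ E

/-- `x` is a hyperbolic affine hypersphere with affine metric `g`, affine normal `ξ` and affine
mean curvature `L`: its affine shape operator is `L · id` for a negative constant `L`.

The last field is the usual convention on the co-orientation, without which "hyperbolic" has no
meaning for convex hypersurfaces: `g` is nowhere negative definite (so where it is definite, it is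
positive definite). -/
structure IsHyperbolicAffineHypersphere (x : M → ι → ℝ)
    (g : ∀ p : M, LinearMap.BilinForm ℝ (TangentSpace I p)) (ξ : M → ι → ℝ) (L : ℝ) : Prop where
  exists_shape : ∃ B : ∀ p : M, TangentSpace I p →ₗ[ℝ] TangentSpace I p,
    IsBlaschkeHypersurface I x g ξ B ∧ (∀ p, affineMeanCurvature I B p = L) ∧
      ∀ p, B p = L • LinearMap.id
  neg : L < 0
  coorientation : ∀ p, ∃ v : TangentSpace I p, 0 < g p v v

end Hypersurface

/-- The point `o` is the affine center of `x` with affine normal `ξ`: all the affine normal lines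
`x p + ℝ ξ p` pass through `o`. -/
def HasAffineCenter {M ι : Type*} (x ξ : M → ι → ℝ) (o : ι → ℝ) : Prop :=
  ∀ p, ∃ s : ℝ, x p + s • ξ p = o

/-- Two maps with the same domain differ by an equiaffine transformation of `ℝ^ι`, that is, by an
affine transformation whose linear part has determinant one. -/
def EquiaffineEquivalent {M ι : Type*} (x y : M → ι → ℝ) : Prop :=
  ∃ T : (ι → ℝ) ≃ᵃ[ℝ] (ι → ℝ),
    LinearMap.det (T.linear : (ι → ℝ) →ₗ[ℝ] (ι → ℝ)) = 1 ∧ ∀ p, y p = T (x p)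

namespace Calabi

/-- `f_a = ∑_{b ≤ a} (n_b + 1)`. -/
def f {k : ℕ} (n : Fin (k + 1) → ℕ) (a : Fin (k + 1)) : ℕ :=
  ∑ b ∈ Finset.Iic a, (n b + 1)

/-- The function `e_a` of `t ∈ ℝ^k`, for `k + 1` factors. Here all indices start from `0`: the
factors are numbered by `a = 0, …, k`, the coordinates of `t` by `l = 0, …, k - 1`, and
`e_a = exp (-t_{a-1} / (n_a + 1) + ∑_{l ≥ a} t_l / f_l)`, without the first term if `a = 0`. -/
def e {k : ℕ} (n : Fin (k + 1) → ℕ) (a : Fin (k + 1)) (t : EuclideanSpace ℝ (Fin k)) : ℝ :=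
  Real.exp (∑ l : Fin k,
    if l.succ = a then -(t l / (n a + 1 : ℝ))
    else if a ≤ l.castSucc then t l / (f n l.castSucc : ℝ)
    else 0)

/-- The map `(t, p) ↦ (c_a e_a(t) x_a(p_a))_a`. The target `∏_a ℝ^{n_a + 1} = ℝ^{n + 1}` is written
as the space of functions on the disjoint union of the index sets of the factors. -/
def composition {k : ℕ} (n : Fin (k + 1) → ℕ) {M : Fin (k + 1) → Type*}
    (x : ∀ a, M a → Fin (n a + 1) → ℝ) (c : Fin (k + 1) → ℝ)
    (q : EuclideanSpace ℝ (Fin k) × (∀ a, M a)) : (Σ a : Fin (k + 1), Fin (n a + 1)) → ℝ :=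
  fun i => c i.1 * e n i.1 q.1 * x i.1 (q.2 i.1) i.2

/-- The constant `C`. Note that `n + 2 = f_K + 1`, where `K = k + 1` is the number of factors. -/
def C {k : ℕ} (n : Fin (k + 1) → ℕ) (L : Fin (k + 1) → ℝ) (c : Fin (k + 1) → ℝ) : ℝ :=
  ((f n (Fin.last k) : ℝ)⁻¹ *
    ∏ a, c a ^ (2 * (n a + 1)) / ((n a + 1 : ℝ) ^ (n a + 1) * (-L a) ^ (n a + 2))) ^
      (1 / (f n (Fin.last k) + 1 : ℝ))

end Calabi

end

/-!
# Calabi compositions of hyperbolic affine hyperspheres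

A hyperbolic affine hypersphere `x` centred at the origin has the affine normal `ξ = -L x`
(`normal_eq_neg_smul`), so all of its equiaffine geometry is carried by one field of bilinear forms
`S` on the ambient space: `S` restricts to the affine metric on the tangent space, the position
vector is orthogonal to the tangent space, and the normal component of the second derivative is read
off by pairing with `x`. In these terms the volume normalisation of `ξ` is no longer a statement
about frames; it prescribes the value of `|det S|`. Both directions of this dictionary are proved:
`IsHyperbolicAffineHypersphere.exists_matrix` produces the form from a hypersphere, and
`isHyperbolicAffineHypersphere_of_matrix` recognises a hypersphere from its form. The two normalise
`S` differently on the position vector: the form of a factor is `-L g` on the tangent space and `1`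
on `x`, which is the shape that enters the composition.

For the composition `(c_a e_a x_a)_a` the ambient form is block diagonal, with the block
`C (n_a + 1) (c_a e_a)⁻² S_a` in the factor `a` (`Calabi.exists_matrix_composition`). At a point,
the position vector has the component `c_a e_a x_a`, and a tangent vector `(s, v)` is sent to
`c_a e_a (α_a(s) x_a + dx_a(v_a))` with `α_a = log e_a` linear. Hence the form takes the value
`C ∑ (n_a + 1) (α_a(s) α_a(s') - L_a g_a(v_a, v_a'))` on two tangent vectors. The weights are such
that `∑ (n_a + 1) α_a = 0`, which gives the orthogonality to the position vector
(`Calabi.sum_logE`), and such that `∑ (n_a + 1) α_a ⊗ α_a` is diagonal in the coordinates `t_l`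
(`Calabi.sum_logE_mul_logE`), which gives the asserted metric. The determinant of the block diagonal
form is a product in which the functions `e_a` cancel, and the constant `C` is exactly the one that
gives it the required value (`Calabi.prod_scale`).

The equiaffine equivalences are diagonal: two compositions with constants `c` and `c'` differ by the
rescaling `c'_a / c_a` of the factors, of determinant one if `∏ c_a ^ (n_a + 1)` and
`∏ c'_a ^ (n_a + 1)` agree.
-/

/-! ### Differentials and second derivatives in a chart -/

section Chart

variable {E : Type*} [NormedAddCommGroup E] [NormedSpace ℝ E]
  {H : Type*} [TopologicalSpace H] {I : ModelWithCorners ℝ E H}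
  {M : Type*} [TopologicalSpace M] [ChartedSpace H M]
  {ι : Type*} [Fintype ι]

/-- Smoothness at `p` is seen in the preferred chart at `p` alone. This needs no compatibility of
charts, so it also applies to product manifolds without an `IsManifold` instance. -/
theorem contMDiffAt_iff_contDiffAt_chart (hI : Set.range I = Set.univ) {x : M → ι → ℝ} {p : M} :
    ContMDiffAt I 𝓘(ℝ, ι → ℝ) ∞ x p ↔ ContinuousAt x p ∧
      ContDiffAt ℝ ∞ (x ∘ (extChartAt I p).symm) (extChartAt I p p) := by
  rw [contMDiffAt_iff, hI, contDiffWithinAt_univ]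
  rfl

theorem differential_eq_fderiv (hI : Set.range I = Set.univ) {x : M → ι → ℝ} {p : M}
    (hx : ContMDiffAt I 𝓘(ℝ, ι → ℝ) ∞ x p) (v : TangentSpace I p) :
    differential I x p v = fderiv ℝ (x ∘ (extChartAt I p).symm) (extChartAt I p p) v := by
  have h : MDifferentiableAt I 𝓘(ℝ, ι → ℝ) x p := hx.mdifferentiableAt (by simp)
  change mfderiv I 𝓘(ℝ, ι → ℝ) x p v = _
  rw [h.mfderiv, hI, fderivWithin_univ]
  rfl

theorem contMDiffAt_const_smul (hI : Set.range I = Set.univ) {x : M → ι → ℝ} {p : M}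
    (hx : ContMDiffAt I 𝓘(ℝ, ι → ℝ) ∞ x p) (r : ℝ) :
    ContMDiffAt I 𝓘(ℝ, ι → ℝ) ∞ (fun p => r • x p) p := by
  have := (contMDiffAt_iff_contDiffAt_chart hI).1 hx
  exact (contMDiffAt_iff_contDiffAt_chart hI).2
    ⟨this.1.const_smul r, contDiffAt_const.smul (f := fun _ => r) this.2⟩

theorem differential_const_smul (hI : Set.range I = Set.univ) {x : M → ι → ℝ} {p : M}
    (hx : ContMDiffAt I 𝓘(ℝ, ι → ℝ) ∞ x p) (r : ℝ) (v : TangentSpace I p) :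
    differential I (fun p => r • x p) p v = r • differential I x p v := by
  rw [differential_eq_fderiv hI (contMDiffAt_const_smul hI hx r), differential_eq_fderiv hI hx]
  have hd : DifferentiableAt ℝ (x ∘ (extChartAt I p).symm) (extChartAt I p p) :=
    ((contMDiffAt_iff_contDiffAt_chart hI).1 hx).2.differentiableAt (by simp)
  exact congrArg (fun T => T v) (fderiv_const_smul hd r)

end Chart

/-! ### Second derivatives of exponentially weighted maps -/

section Calculus

variable {W F : Type*} [NormedAddCommGroup W] [NormedSpace ℝ W]
  [NormedAddCommGroup F] [NormedSpace ℝ F] {ι : Type*}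

theorem fderiv_apply_coord {κ : Type*} [Finite κ] {y : W → κ → ℝ} {w : W}
    (hy : DifferentiableAt ℝ y w) (v : W) (i : κ) :
    fderiv ℝ y w v i = fderiv ℝ (fun w => y w i) w v := by
  rw [fderiv_apply hy]
  rfl

theorem fderiv_fderiv_apply_coord [Fintype ι] {y : W → ι → ℝ} {w : W} (hy : ContDiffAt ℝ ∞ y w)
    (v v' : W) (i : ι) :
    fderiv ℝ (fderiv ℝ y) w v v' i = fderiv ℝ (fderiv ℝ fun w => y w i) w v v' := by
  have hev : (fderiv ℝ fun w => y w i) =ᶠ[nhds w]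
      fun w => (ContinuousLinearMap.proj (R := ℝ) (φ := fun _ : ι => ℝ) i).comp (fderiv ℝ y w) := by
    have h1 : ∀ᶠ w' in nhds w, ContDiffAt ℝ 1 y w' :=
      (hy.of_le (m := 1) (mod_cast le_top)).eventually (by simp)
    filter_upwards [h1] with w' hw'
    exact fderiv_apply (hw'.differentiableAt (by simp)) i
  have hd : DifferentiableAt ℝ (fderiv ℝ y) w :=
    (hy.fderiv_right (m := ∞) le_rfl).differentiableAt (by simp)
  have hL := ((ContinuousLinearMap.compL ℝ W (ι → ℝ) ℝ
    (ContinuousLinearMap.proj (R := ℝ) (φ := fun _ : ι => ℝ) i)).hasFDerivAt.comp w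
      hd.hasFDerivAt).fderiv
  rw [hev.fderiv_eq]
  exact (congrArg (fun T => T v v') hL).symm

theorem hasFDerivAt_exp_mul_comp (c : ℝ) (β : W →L[ℝ] ℝ) (π : W →L[ℝ] F) {y : F → ℝ} {w : W}
    (hy : DifferentiableAt ℝ y (π w)) :
    HasFDerivAt (fun w => c * Real.exp (β w) * y (π w))
      ((c * Real.exp (β w)) • (y (π w) • β + (fderiv ℝ y (π w)).comp π)) w := by
  have h1 : HasFDerivAt (fun w => c * Real.exp (β w)) (c • (Real.exp (β w) • β)) w :=
    (β.hasFDerivAt.exp).const_mul c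
  have h2 : HasFDerivAt (fun w => y (π w)) ((fderiv ℝ y (π w)).comp π) w :=
    hy.hasFDerivAt.comp w π.hasFDerivAt
  refine (h1.mul h2).congr_fderiv ?_
  ext v
  simp
  ring

/-- The second derivative of `c exp(β) · (y ∘ π)` with `β` and `π` linear, which is the shape of
every coordinate of a Calabi composition in a product chart. -/
theorem fderiv_fderiv_exp_mul_comp (c : ℝ) (β : W →L[ℝ] ℝ) (π : W →L[ℝ] F) {y : F → ℝ} {w : W}
    (hy : ContDiffAt ℝ ∞ y (π w)) (v v' : W) :
    fderiv ℝ (fderiv ℝ fun w => c * Real.exp (β w) * y (π w)) w v v' =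
      c * Real.exp (β w) * (β v * β v' * y (π w) + β v * fderiv ℝ y (π w) (π v') +
        β v' * fderiv ℝ y (π w) (π v) + fderiv ℝ (fderiv ℝ y) (π w) (π v) (π v')) := by
  have h1 : ∀ᶠ u in nhds (π w), ContDiffAt ℝ 1 y u :=
    (hy.of_le (m := 1) (mod_cast le_top)).eventually (by simp)
  have hev : (fderiv ℝ fun w => c * Real.exp (β w) * y (π w)) =ᶠ[nhds w]
      fun w => (c * Real.exp (β w)) • (y (π w) • β + (fderiv ℝ y (π w)).comp π) := by
    filter_upwards [π.continuous.continuousAt.eventually h1] with w' hw'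
    exact (hasFDerivAt_exp_mul_comp c β π (hw'.differentiableAt (by simp))).fderiv
  have hd : HasFDerivAt (fderiv ℝ y) (fderiv ℝ (fderiv ℝ y) (π w)) (π w) :=
    ((hy.fderiv_right (m := ∞) le_rfl).differentiableAt (by simp)).hasFDerivAt
  have hy' : DifferentiableAt ℝ y (π w) := hy.differentiableAt (by simp)
  have e1 : HasFDerivAt (fun w => c * Real.exp (β w)) (c • (Real.exp (β w) • β)) w :=
    (β.hasFDerivAt.exp).const_mul c
  have e2 : HasFDerivAt (fun w => y (π w)) ((fderiv ℝ y (π w)).comp π) w :=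
    hy'.hasFDerivAt.comp w π.hasFDerivAt
  have e3 := (hd.comp w π.hasFDerivAt).clm_comp (hasFDerivAt_const π w)
  have e4 := e1.smul ((e2.smul_const β).add e3)
  rw [hev.fderiv_eq]
  have e5 : fderiv ℝ (fun w => (c * Real.exp (β w)) • (y (π w) • β + (fderiv ℝ y (π w)).comp π)) w
      = _ := e4.fderiv
  rw [e5]
  simp
  ring

end Calculus

/-! ### Gram determinants -/

section Gram

/-- The determinant of a form on `ℝ^ι`, computed in a frame `(Z, ζ)` with `ζ` orthogonal to `Z`. -/
theorem det_sq_mul_det_eq_of_orthogonal {ι κ : Type*} [Fintype ι] [DecidableEq ι] [Fintype κ]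
    [DecidableEq κ] (S : Matrix ι ι ℝ) (σ : ι ≃ Option κ) (Z : κ → ι → ℝ) (ζ : ι → ℝ)
    (h₁ : ∀ j, Matrix.toLinearMap₂' ℝ S (Z j) ζ = 0)
    (h₂ : ∀ j, Matrix.toLinearMap₂' ℝ S ζ (Z j) = 0) :
    (Matrix.of fun i : ι => (σ i).elim ζ Z).det ^ 2 * S.det =
      Matrix.toLinearMap₂' ℝ S ζ ζ *
        (Matrix.of fun j l : κ => Matrix.toLinearMap₂' ℝ S (Z j) (Z l)).det := by
  set P : Matrix ι ι ℝ := Matrix.of fun i : ι => (σ i).elim ζ Z with hP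
  have hPS : P * S * P.transpose = (Matrix.fromBlocks
      (Matrix.of fun j l : κ => Matrix.toLinearMap₂' ℝ S (Z j) (Z l)) 0 0
      (Matrix.of fun _ _ : Unit => Matrix.toLinearMap₂' ℝ S ζ ζ)).submatrix
        (σ.trans (Equiv.optionEquivSumPUnit κ)) (σ.trans (Equiv.optionEquivSumPUnit κ)) := by
    ext i i'
    have h : (P * S * P.transpose) i i' = Matrix.toLinearMap₂' ℝ S (P i) (P i') := by
      rw [Matrix.toLinearMap₂'_apply', Matrix.mul_assoc, Matrix.mul_apply]
      rfl
    rw [h]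
    have hi : P i = (σ i).elim ζ Z := rfl
    have hi' : P i' = (σ i').elim ζ Z := rfl
    rw [hi, hi']
    simp only [Matrix.submatrix_apply, Equiv.trans_apply]
    rcases σ i with _ | j <;> rcases σ i' with _ | l <;> simp [h₁, h₂]
  have := congrArg Matrix.det hPS
  rw [Matrix.det_submatrix_equiv_self, Matrix.det_fromBlocks_zero₂₁, Matrix.det_mul, Matrix.det_mul,
    Matrix.det_transpose, Matrix.det_unique (Matrix.of fun _ _ : Unit => _)] at this
  simp only [Matrix.of_apply] at this
  linear_combination this

/-- The determinant of a block diagonal matrix whose blocks may have different sizes. -/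
theorem det_blockDiagonal_sigma {o : Type*} [Fintype o] [LinearOrder o] {m : o → Type*}
    [∀ a, Fintype (m a)] [∀ a, DecidableEq (m a)] (S : ∀ a, Matrix (m a) (m a) ℝ) :
    (Matrix.blockDiagonal' S).det = ∏ a, (S a).det := by
  have hb : (Matrix.blockDiagonal' S).BlockTriangular Sigma.fst := by
    intro i j hij
    exact Matrix.blockDiagonal'_apply_ne S i.2 j.2 hij.ne'
  rw [hb.det_fintype]
  refine Finset.prod_congr rfl fun a _ => ?_
  let ε : m a ≃ {i : Σ a, m a // i.1 = a} :=
    { toFun := fun j => ⟨⟨a, j⟩, rfl⟩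
      invFun := fun i => i.2 ▸ i.1.2
      left_inv := fun _ => rfl
      right_inv := by rintro ⟨⟨b, j⟩, rfl⟩; rfl }
  rw [← Matrix.det_submatrix_equiv_self ε]
  congr 1
  ext i j
  simp [ε, Matrix.toSquareBlock, Matrix.toSquareBlockProp, Matrix.blockDiagonal'_apply_eq]

theorem toLinearMap₂'_blockDiagonal {o : Type*} [Fintype o] [DecidableEq o] {m : o → Type*}
    [∀ a, Fintype (m a)] [∀ a, DecidableEq (m a)] (S : ∀ a, Matrix (m a) (m a) ℝ)
    (y y' : (Σ a, m a) → ℝ) :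
    Matrix.toLinearMap₂' ℝ (Matrix.blockDiagonal' S) y y' =
      ∑ a, Matrix.toLinearMap₂' ℝ (S a) (fun j => y ⟨a, j⟩) (fun j => y' ⟨a, j⟩) := by
  simp only [Matrix.toLinearMap₂'_apply', dotProduct, Matrix.mulVec, Fintype.sum_sigma]
  refine Finset.sum_congr rfl fun a _ => Finset.sum_congr rfl fun j _ => ?_
  congr 1
  rw [Finset.sum_eq_single a]
  · simp only [Matrix.blockDiagonal'_apply_eq]
  · intro b _ hb
    refine Finset.sum_eq_zero fun l _ => ?_
    rw [Matrix.blockDiagonal'_apply_ne S j l hb.symm, zero_mul]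
  · simp

/-- A hyperplane, given as the image of `D`, and a transversal vector `x` span the space. -/
theorem exists_linearEquiv_of_transversal {V ι : Type*} [AddCommGroup V] [Module ℝ V]
    [FiniteDimensional ℝ V] [Fintype ι] (D : V →ₗ[ℝ] ι → ℝ) (x : ι → ℝ)
    (hcard : Fintype.card ι = Module.finrank ℝ V + 1) (hD : Function.Injective D)
    (hx : ∀ v, D v ≠ x) :
    ∃ Ψ : (ℝ × V) ≃ₗ[ℝ] ι → ℝ, ∀ r v, Ψ (r, v) = r • x + D v := by
  let ψ : (ℝ × V) →ₗ[ℝ] ι → ℝ := (LinearMap.toSpanSingleton ℝ (ι → ℝ) x).coprod D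
  have hψ : ∀ r v, ψ (r, v) = r • x + D v := fun r v => by simp [ψ]
  have hinj : Function.Injective ψ := by
    rw [← LinearMap.ker_eq_bot, LinearMap.ker_eq_bot']
    rintro ⟨r, v⟩ h
    rw [hψ] at h
    have hr : r = 0 := by
      by_contra hr
      refine hx (-r⁻¹ • v) ?_
      have h' : D v = -(r • x) := (neg_eq_of_add_eq_zero_right h).symm
      rw [map_smul, h', smul_neg, neg_smul, neg_neg, smul_smul, inv_mul_cancel₀ hr, one_smul]
    subst hr
    rw [zero_smul, zero_add] at h
    have hv : v = 0 := hD (h.trans (map_zero D).symm)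
    rw [hv]
    rfl
  have hfin : Module.finrank ℝ (ℝ × V) = Module.finrank ℝ (ι → ℝ) := by
    rw [Module.finrank_prod, Module.finrank_self, Module.finrank_fintype_fun_eq_card, hcard,
      add_comm]
  exact ⟨LinearEquiv.ofInjectiveOfFinrankEq ψ hinj hfin, hψ⟩

/-- A form on a hyperplane, given as the image of `D`, extends to the whole space with a prescribed
transversal vector `x` as orthogonal unit vector. -/
theorem exists_matrix_extending_form {V ι : Type*} [AddCommGroup V] [Module ℝ V]
    [FiniteDimensional ℝ V] [Fintype ι] [DecidableEq ι] (D : V →ₗ[ℝ] ι → ℝ) (x : ι → ℝ)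
    (hcard : Fintype.card ι = Module.finrank ℝ V + 1) (hD : Function.Injective D)
    (hx : ∀ v, D v ≠ x) (g : LinearMap.BilinForm ℝ V) :
    ∃ S : Matrix ι ι ℝ, ∀ (r r' : ℝ) (v v' : V),
      Matrix.toLinearMap₂' ℝ S (r • x + D v) (r' • x + D v') = r * r' + g v v' := by
  obtain ⟨Ψ, hΨ⟩ := exists_linearEquiv_of_transversal D x hcard hD hx
  have hΨ' : ∀ r v, Ψ.symm (r • x + D v) = (r, v) := fun r v => by
    rw [LinearEquiv.symm_apply_eq, hΨ]
  let R : LinearMap.BilinForm ℝ (ℝ × V) :=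
    (LinearMap.mul ℝ ℝ).compl₁₂ (LinearMap.fst ℝ ℝ V) (LinearMap.fst ℝ ℝ V) +
      g.compl₁₂ (LinearMap.snd ℝ ℝ V) (LinearMap.snd ℝ ℝ V)
  refine ⟨LinearMap.toMatrix₂' ℝ (R.compl₁₂ Ψ.symm.toLinearMap Ψ.symm.toLinearMap), ?_⟩
  intro r r' v v'
  rw [Matrix.toLinearMap₂'_toMatrix']
  simp only [LinearMap.compl₁₂_apply, LinearEquiv.coe_coe, hΨ']
  simp [R]

end Gram

/-! ### Hyperbolic affine hyperspheres centred at the origin -/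

section Centred

variable {E : Type*} [NormedAddCommGroup E] [NormedSpace ℝ E]
  {H : Type*} [TopologicalSpace H] {I : ModelWithCorners ℝ E H}
  {M : Type*} [TopologicalSpace M] [ChartedSpace H M]
  {ι : Type*} [Fintype ι] [DecidableEq ι]

/-- The quadratic form given by `S p` on `ℝ^ι` encodes the Blaschke structure of a hypersphere
centred at the origin: it restricts to `g` on the tangent space, the position vector is orthogonal
to the tangent space, and the volume normalisation prescribes `det S`. -/
theorem isHyperbolicAffineHypersphere_of_matrix [FiniteDimensional ℝ E] (hI : Set.range I = Set.univ)
    {x : M → ι → ℝ} {g : ∀ p : M, LinearMap.BilinForm ℝ (TangentSpace I p)} {L : ℝ} (hL : L < 0)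
    (hcard : Fintype.card ι = Module.finrank ℝ E + 1)
    (hx : ContMDiff I 𝓘(ℝ, ι → ℝ) ∞ x) (hg : ∀ p, (g p).Nondegenerate)
    (hpos : ∀ p, ∃ v : TangentSpace I p, 0 < g p v v)
    (S : M → Matrix ι ι ℝ) (hdet : ∀ p, |(S p).det| = -L)
    (h₁ : ∀ p (v w : TangentSpace I p),
      Matrix.toLinearMap₂' ℝ (S p) (differential I x p v) (differential I x p w) = g p v w)
    (h₂ : ∀ p (v : TangentSpace I p),
      Matrix.toLinearMap₂' ℝ (S p) (differential I x p v) (x p) = 0)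
    (h₃ : ∀ p (v : TangentSpace I p),
      Matrix.toLinearMap₂' ℝ (S p) (x p) (differential I x p v) = 0)
    (h₄ : ∀ p, Matrix.toLinearMap₂' ℝ (S p) (x p) (x p) = (-L)⁻¹)
    (h₅ : ∀ p (v w : TangentSpace I p),
      Matrix.toLinearMap₂' ℝ (S p) (chartHessian I x p v w) (x p) = g p v w) :
    IsHyperbolicAffineHypersphere I x g (fun p => (-L) • x p) L ∧
      HasAffineCenter x (fun p => (-L) • x p) 0 := by
  have hL' : -L ≠ 0 := (neg_pos.2 hL).ne'
  have hinj : ∀ p, Function.Injective (differential I x p) := by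
    intro p
    rw [← LinearMap.ker_eq_bot, LinearMap.ker_eq_bot']
    intro v hv
    refine (hg p).1 v fun w => ?_
    rw [← h₁, hv, map_zero, LinearMap.zero_apply]
  have htrans : ∀ p (v : TangentSpace I p), differential I x p v ≠ (-L) • x p := by
    intro p v h
    have h' := h₂ p v
    rw [h, map_smul, LinearMap.smul_apply, h₄, smul_eq_mul, mul_inv_cancel₀ hL'] at h'
    exact one_ne_zero h'
  have hsm : ContMDiff I 𝓘(ℝ, ι → ℝ) ∞ (fun p => (-L) • x p) := fun p =>
    contMDiffAt_const_smul hI (hx p) (-L)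
  refine ⟨⟨⟨fun p => L • LinearMap.id, ⟨hcard, hx, hinj, hsm, htrans, hg, ?_, ?_, ?_⟩, ?_,
    fun p => rfl⟩, hL, hpos⟩, fun p => ⟨L⁻¹, ?_⟩⟩
  · intro p v w
    have : FiniteDimensional ℝ (TangentSpace I p) := inferInstanceAs (FiniteDimensional ℝ E)
    obtain ⟨Ψ, hΨ⟩ := exists_linearEquiv_of_transversal (differential I x p) ((-L) • x p) hcard
      (hinj p) (htrans p)
    obtain ⟨⟨r, z⟩, hz⟩ := Ψ.surjective (chartHessian I x p v w)
    rw [hΨ] at hz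
    refine ⟨z, ?_⟩
    -- The normal component is read off by pairing with the position vector.
    have h := h₅ p v w
    rw [← hz, map_add, LinearMap.add_apply, h₂, add_zero, map_smul, map_smul, LinearMap.smul_apply,
      LinearMap.smul_apply, h₄, smul_eq_mul, smul_eq_mul, mul_inv_cancel₀ hL', mul_one] at h
    rw [← hz, h, add_comm]
  · intro p v
    rw [differential_const_smul hI (hx p), LinearMap.smul_apply, map_smul, LinearMap.id_apply,
      neg_smul]
  · intro p κ _ _ σ X
    have h := det_sq_mul_det_eq_of_orthogonal (S p) σ (fun j => differential I x p (X j))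
      ((-L) • x p) (fun j => by rw [map_smul, h₂, smul_zero])
      (fun j => by rw [map_smul, LinearMap.smul_apply, h₃, smul_zero])
    simp only [h₁, map_smul, LinearMap.smul_apply, h₄, smul_eq_mul, mul_inv_cancel₀ hL',
      mul_one] at h
    have h' := congrArg abs h
    rw [abs_mul, abs_mul, hdet, abs_of_pos (neg_pos.2 hL), mul_comm] at h'
    rw [← mul_left_cancel₀ hL' h', abs_pow, Real.sqrt_sq (abs_nonneg _)]
  · intro p
    obtain ⟨v, hv⟩ := hpos p
    have hfin : (Module.finrank ℝ E : ℝ) ≠ 0 := by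
      intro h0
      have : Subsingleton E := Module.finrank_zero_iff.1 (by exact_mod_cast h0)
      have hv0 : v = 0 := Subsingleton.elim (α := E) v 0
      rw [hv0, map_zero] at hv
      exact lt_irrefl _ hv
    have ht : LinearMap.trace ℝ E (L • LinearMap.id) = L * Module.finrank ℝ E := by
      rw [map_smul, LinearMap.trace_id, smul_eq_mul]
    exact (congrArg (· / (Module.finrank ℝ E : ℝ)) ht).trans (mul_div_cancel_right₀ _ hfin)
  · rw [smul_smul, mul_neg, inv_mul_cancel₀ hL.ne, neg_one_smul, add_neg_cancel]

/-- The centre condition determines the affine normal. The normal lines pass through the origin, so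
`x` and `ξ` are parallel; differentiating this relation shows that every `dx v` would be parallel to
`ξ` unless `ξ = -L x`. -/
theorem normal_eq_neg_smul (hI : Set.range I = Set.univ) {x ξ : M → ι → ℝ}
    {g : ∀ p : M, LinearMap.BilinForm ℝ (TangentSpace I p)} {L : ℝ}
    (hx : IsHyperbolicAffineHypersphere I x g ξ L) (hc : HasAffineCenter x ξ 0) (p : M) :
    ξ p = (-L) • x p := by
  obtain ⟨B, hB, -, hBL⟩ := hx.exists_shape
  have hpar : ∀ p i j, x p j * ξ p i = x p i * ξ p j := by
    intro p i j
    obtain ⟨s, hs⟩ := hc p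
    have h : ∀ i, x p i = -(s * ξ p i) := fun i => by
      have := congrFun hs i
      simp only [Pi.add_apply, Pi.smul_apply, smul_eq_mul, Pi.zero_apply] at this
      linarith
    rw [h, h]
    ring
  obtain ⟨v, hv⟩ := hx.coorientation p
  have hv0 : v ≠ 0 := by
    rintro rfl
    rw [map_zero] at hv
    exact lt_irrefl _ hv
  have hdx : ∀ i, DifferentiableAt ℝ (fun w => x ((extChartAt I p).symm w) i) (extChartAt I p p) :=
    differentiableAt_pi.1
      (((contMDiffAt_iff_contDiffAt_chart hI).1 (hB.smooth p)).2.differentiableAt (by simp))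
  have hdξ : ∀ i, DifferentiableAt ℝ (fun w => ξ ((extChartAt I p).symm w) i) (extChartAt I p p) :=
    differentiableAt_pi.1
      (((contMDiffAt_iff_contDiffAt_chart hI).1 (hB.smooth_normal p)).2.differentiableAt (by simp))
  have hx' : ∀ i, differential I x p v i =
      fderiv ℝ (fun w => x ((extChartAt I p).symm w) i) (extChartAt I p p) v := by
    intro i
    rw [differential_eq_fderiv hI (hB.smooth p)]
    exact fderiv_apply_coord (differentiableAt_pi.2 hdx) v i
  have hξ' : ∀ i, -(L * differential I x p v i) =
      fderiv ℝ (fun w => ξ ((extChartAt I p).symm w) i) (extChartAt I p p) v := by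
    intro i
    have h := congrFun (hB.weingarten p v) i
    rw [hBL, LinearMap.smul_apply, map_smul, LinearMap.id_apply,
      differential_eq_fderiv hI (hB.smooth_normal p)] at h
    rw [show -(L * differential I x p v i) = (-(L • differential I x p v)) i from rfl, ← h]
    exact fderiv_apply_coord (differentiableAt_pi.2 hdξ) v i
  -- The derivative of `hpar` in the direction `v`, with `dξ = -L dx` inserted.
  have hder : ∀ i j, differential I x p v j * (ξ p i + L * x p i) =
      differential I x p v i * (ξ p j + L * x p j) := by
    intro i j
    have h1 := (hdx j).hasFDerivAt.mul (hdξ i).hasFDerivAt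
    have h2 := (hdx i).hasFDerivAt.mul (hdξ j).hasFDerivAt
    have hfun : ((fun w => x ((extChartAt I p).symm w) j) * fun w => ξ ((extChartAt I p).symm w) i) =
        (fun w => x ((extChartAt I p).symm w) i) * fun w => ξ ((extChartAt I p).symm w) j :=
      funext fun w => hpar _ i j
    rw [hfun] at h1
    have h3 : x ((extChartAt I p).symm (extChartAt I p p)) j * -(L * differential I x p v i) +
        ξ ((extChartAt I p).symm (extChartAt I p p)) i * differential I x p v j =
        x ((extChartAt I p).symm (extChartAt I p p)) i * -(L * differential I x p v j) +
        ξ ((extChartAt I p).symm (extChartAt I p p)) j * differential I x p v i := by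
      rw [hξ' i, hξ' j, hx' i, hx' j]
      exact congrArg (fun T => T v) (h1.unique h2)
    rw [extChartAt_to_inv] at h3
    linear_combination h3
  obtain ⟨s, hs⟩ := hc p
  have hxs : ∀ i, x p i = -(s * ξ p i) := fun i => by
    have := congrFun hs i
    simp only [Pi.add_apply, Pi.smul_apply, smul_eq_mul, Pi.zero_apply] at this
    linarith
  have hsL : 1 - L * s = 0 := by
    by_contra hne
    have hξ0 : ξ p ≠ 0 := fun h => hB.transversal p 0 (by rw [map_zero, h])
    obtain ⟨i, hi⟩ := Function.ne_iff.1 hξ0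
    have hi' : ξ p i ≠ 0 := hi
    have hd : ∀ j, differential I x p v j = differential I x p v i / ξ p i * ξ p j := by
      intro j
      have h := hder i j
      rw [hxs i, hxs j] at h
      have h' : (1 - L * s) * (differential I x p v j * ξ p i) =
          (1 - L * s) * (differential I x p v i * ξ p j) := by linear_combination h
      have := mul_left_cancel₀ hne h'
      field_simp
      linarith
    obtain ⟨μ, hμ⟩ : ∃ μ : ℝ, differential I x p v = μ • ξ p := ⟨_, funext hd⟩
    by_cases hμ0 : μ = 0
    · rw [hμ0, zero_smul] at hμ
      exact hv0 (hB.immersion p (hμ.trans (map_zero _).symm))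
    · refine hB.transversal p (μ⁻¹ • v) ?_
      rw [map_smul, hμ, smul_smul, inv_mul_cancel₀ hμ0, one_smul]
  ext i
  rw [Pi.smul_apply, smul_eq_mul, hxs i]
  linear_combination (-ξ p i) * hsL + 2 * ξ p i * hsL

/-- The converse of `isHyperbolicAffineHypersphere_of_matrix`, with the position vector normalised
to length one. -/
theorem IsHyperbolicAffineHypersphere.exists_matrix [FiniteDimensional ℝ E]
    (hI : Set.range I = Set.univ) {x ξ : M → ι → ℝ}
    {g : ∀ p : M, LinearMap.BilinForm ℝ (TangentSpace I p)} {L : ℝ}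
    (hx : IsHyperbolicAffineHypersphere I x g ξ L) (hc : HasAffineCenter x ξ 0) (p : M) :
    ∃ S : Matrix ι ι ℝ, (∀ (r r' : ℝ) (v v' : TangentSpace I p),
      Matrix.toLinearMap₂' ℝ S (r • x p + differential I x p v)
        (r' • x p + differential I x p v') = r * r' + -L * g p v v') ∧
      |S.det| = (-L) ^ (Module.finrank ℝ E + 2) := by
  obtain ⟨B, hB, -, hBL⟩ := hx.exists_shape
  have hξ := normal_eq_neg_smul hI hx hc p
  have hL : 0 < -L := neg_pos.2 hx.neg
  have : FiniteDimensional ℝ (TangentSpace I p) := inferInstanceAs (FiniteDimensional ℝ E)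
  have htr : ∀ v, differential I x p v ≠ x p := by
    intro v h
    refine hB.transversal p ((-L) • v) ?_
    rw [map_smul, h, hξ]
  obtain ⟨S, hS⟩ := exists_matrix_extending_form (differential I x p) (x p) hB.codim_one
    (hB.immersion p) htr ((-L) • g p)
  refine ⟨S, fun r r' v v' => (hS r r' v v').trans rfl, ?_⟩
  have hS₁ : ∀ v w, Matrix.toLinearMap₂' ℝ S (differential I x p v) (differential I x p w) =
      -L * g p v w := fun v w => by simpa using hS 0 0 v w
  have hS₂ : ∀ v, Matrix.toLinearMap₂' ℝ S (differential I x p v) (x p) = 0 := fun v => by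
    simpa using hS 0 1 v 0
  have hS₃ : ∀ v, Matrix.toLinearMap₂' ℝ S (x p) (differential I x p v) = 0 := fun v => by
    simpa using hS 1 0 0 v
  have hS₄ : Matrix.toLinearMap₂' ℝ S (x p) (x p) = 1 := by
    simpa using hS 1 1 0 0
  let b : Module.Basis (Fin (Module.finrank ℝ E)) ℝ (TangentSpace I p) := Module.finBasis ℝ E
  obtain ⟨σ⟩ : Nonempty (ι ≃ Option (Fin (Module.finrank ℝ E))) :=
    Fintype.card_eq.1 (by rw [hB.codim_one, Fintype.card_option, Fintype.card_fin])
  -- Both sides of the volume normalisation are evaluated in the frame `(dx b_j, ξ)`; the metric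
  -- determinant then cancels because it is nonzero.
  have hvol := hB.volume_eq p σ b
  have hdet := det_sq_mul_det_eq_of_orthogonal S σ (fun j => differential I x p (b j)) (ξ p)
    (fun j => by rw [hξ, map_smul, hS₂, smul_zero])
    (fun j => by rw [hξ, map_smul, LinearMap.smul_apply, hS₃, smul_zero])
  have hg0 : (Matrix.of fun j l => g p (b j) (b l)).det ≠ 0 := by
    have := (LinearMap.BilinForm.nondegenerate_iff_det_ne_zero (B := g p) b).1 (hB.nondegenerate p)
    convert this using 2
    ext j l
    simp [LinearMap.BilinForm.toMatrix_apply]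
  have hscale : (Matrix.of fun j l => -L * g p (b j) (b l)).det =
      (-L) ^ Module.finrank ℝ E * (Matrix.of fun j l => g p (b j) (b l)).det := by
    have := Matrix.det_smul (Matrix.of fun j l => g p (b j) (b l)) (-L)
    rw [Fintype.card_fin] at this
    rw [← this]
    rfl
  have hξξ : Matrix.toLinearMap₂' ℝ S (ξ p) (ξ p) = (-L) ^ 2 := by
    rw [hξ, map_smul, map_smul, LinearMap.smul_apply, hS₄]
    simp [sq]
  simp only [hS₁] at hdet
  rw [hscale, hξξ] at hdet
  have hsq : (Matrix.of fun i : ι => (σ i).elim (ξ p) fun j => differential I x p (b j)).det ^ 2 =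
      |(Matrix.of fun j l => g p (b j) (b l)).det| := by
    rw [← sq_abs, hvol, Real.sq_sqrt (abs_nonneg _)]
  rw [hsq] at hdet
  have h := congrArg abs hdet
  rw [abs_mul, abs_abs, abs_mul, abs_mul, abs_of_pos (pow_pos hL _), abs_of_pos (pow_pos hL _)] at h
  refine mul_left_cancel₀ (abs_ne_zero.2 hg0) (h.trans ?_)
  ring

end Centred

/-! ### The weights -/

namespace Calabi

variable {k : ℕ} (n : Fin (k + 1) → ℕ)

theorem f_pos (a : Fin (k + 1)) : (0 : ℝ) < f n a := by
  unfold f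
  have : 0 < ∑ b ∈ Finset.Iic a, (n b + 1) :=
    Finset.sum_pos (fun _ _ => Nat.succ_pos _) ⟨a, by simp⟩
  exact_mod_cast this

theorem cast_f (a : Fin (k + 1)) :
    (f n a : ℝ) = ∑ b, if b ≤ a then (n b + 1 : ℝ) else 0 := by
  rw [← Finset.sum_filter]
  have : Finset.univ.filter (fun b => b ≤ a) = Finset.Iic a := by ext; simp
  rw [this]
  simp [f]

theorem cast_f_last : (f n (Fin.last k) : ℝ) = ∑ b, (n b + 1 : ℝ) := by
  simp [cast_f, Fin.le_last]

theorem f_last : f n (Fin.last k) = ∑ b, (n b + 1) := by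
  have := cast_f_last n
  exact_mod_cast this

theorem f_succ (l : Fin k) : (f n l.succ : ℝ) = f n l.castSucc + (n l.succ + 1) := by
  have h : Finset.Iic l.succ = insert l.succ (Finset.Iic l.castSucc) := by
    ext b
    simp only [Finset.mem_Iic, Finset.mem_insert, Fin.le_def, Fin.ext_iff, Fin.val_succ,
      Fin.val_castSucc]
    omega
  have h' : l.succ ∉ Finset.Iic l.castSucc := by simp [Fin.le_def]
  simp only [f, h, Finset.sum_insert h']
  push_cast
  ring

/-- The coefficient of `t_l` in `log e_a`. -/
noncomputable def logCoeff (a : Fin (k + 1)) (l : Fin k) : ℝ :=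
  if l.succ = a then -(n a + 1 : ℝ)⁻¹ else if a ≤ l.castSucc then (f n l.castSucc : ℝ)⁻¹ else 0

/-- The linear form `log e_a`. -/
noncomputable def logE (a : Fin (k + 1)) : EuclideanSpace ℝ (Fin k) →L[ℝ] ℝ :=
  ∑ l, logCoeff n a l • EuclideanSpace.proj l

theorem logE_apply (a : Fin (k + 1)) (t : EuclideanSpace ℝ (Fin k)) :
    logE n a t = ∑ l, logCoeff n a l * t l := by
  simp [logE]

theorem e_eq_exp (a : Fin (k + 1)) (t : EuclideanSpace ℝ (Fin k)) :
    e n a t = Real.exp (logE n a t) := by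
  rw [e, logE_apply]
  congr 1
  refine Finset.sum_congr rfl fun l _ => ?_
  unfold logCoeff
  split_ifs <;> ring

theorem sum_logCoeff (l : Fin k) : ∑ a, (n a + 1 : ℝ) * logCoeff n a l = 0 := by
  have h : ∀ a, (n a + 1 : ℝ) * logCoeff n a l = (if l.succ = a then (-1 : ℝ) else 0) +
      (if a ≤ l.castSucc then (n a + 1 : ℝ) else 0) * (f n l.castSucc : ℝ)⁻¹ := by
    intro a
    have : (n a + 1 : ℝ) ≠ 0 := by positivity
    unfold logCoeff
    split_ifs with h1 h2
    · subst h1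
      exact absurd h2 (by simp [Fin.le_def])
    · field_simp
      ring
    · ring
    · ring
  simp only [h, Finset.sum_add_distrib, ← Finset.sum_mul, ← cast_f, Finset.sum_ite_eq,
    Finset.mem_univ, if_true]
  rw [mul_inv_cancel₀ (f_pos n _).ne']
  ring

theorem sum_logCoeff_mul_of_lt {l m : Fin k} (hlm : l < m) :
    ∑ a, (n a + 1 : ℝ) * (logCoeff n a l * logCoeff n a m) = 0 := by
  -- On the support `a ≤ l + 1` of the coefficients of `t_l`, those of `t_m` are constant.
  have h : ∀ a, (n a + 1 : ℝ) * (logCoeff n a l * logCoeff n a m) =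
      (n a + 1 : ℝ) * logCoeff n a l * (f n m.castSucc : ℝ)⁻¹ := by
    intro a
    by_cases ha : a ≤ l.succ
    · have h1 : m.succ ≠ a := by
        rintro rfl
        simp only [Fin.le_def, Fin.val_succ, Fin.lt_def] at ha hlm
        omega
      have h2 : a ≤ m.castSucc := by
        simp only [Fin.le_def, Fin.val_succ, Fin.lt_def, Fin.val_castSucc] at ha hlm ⊢
        omega
      have h3 : logCoeff n a m = (f n m.castSucc : ℝ)⁻¹ := by simp [logCoeff, h1, h2]
      rw [h3]
      ring
    · have h1 : l.succ ≠ a := fun h => ha h.ge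
      have h2 : ¬ a ≤ l.castSucc := by
        simp only [Fin.le_def, Fin.val_succ, Fin.val_castSucc] at ha ⊢
        omega
      have h3 : logCoeff n a l = 0 := by simp [logCoeff, h1, h2]
      rw [h3]
      ring
  simp only [h, ← Finset.sum_mul, sum_logCoeff, zero_mul]

theorem sum_logCoeff_sq (l : Fin k) :
    ∑ a, (n a + 1 : ℝ) * (logCoeff n a l * logCoeff n a l) =
      f n l.succ / ((n l.succ + 1) * f n l.castSucc) := by
  have h : ∀ a, (n a + 1 : ℝ) * (logCoeff n a l * logCoeff n a l) =
      (if l.succ = a then (n l.succ + 1 : ℝ)⁻¹ else 0) +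
      (if a ≤ l.castSucc then (n a + 1 : ℝ) else 0) * ((f n l.castSucc : ℝ)⁻¹ ^ 2) := by
    intro a
    have : (n a + 1 : ℝ) ≠ 0 := by positivity
    unfold logCoeff
    split_ifs with h1 h2
    · subst h1
      exact absurd h2 (by simp [Fin.le_def])
    · subst h1
      field_simp
      ring
    · ring
    · ring
  have hf := (f_pos n l.castSucc).ne'
  have hn : (n l.succ + 1 : ℝ) ≠ 0 := by positivity
  simp only [h, Finset.sum_add_distrib, ← Finset.sum_mul, ← cast_f, Finset.sum_ite_eq,
    Finset.mem_univ, if_true]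
  rw [f_succ]
  field_simp

/-- The relation `∏ e_a ^ (n_a + 1) = 1` in logarithmic form. -/
theorem sum_logE (s : EuclideanSpace ℝ (Fin k)) : ∑ a, (n a + 1 : ℝ) * logE n a s = 0 := by
  simp only [logE_apply, Finset.mul_sum]
  rw [Finset.sum_comm]
  refine Finset.sum_eq_zero fun l _ => ?_
  simp only [← mul_assoc, ← Finset.sum_mul, sum_logCoeff, zero_mul]

/-- The linear forms `log e_a` diagonalise the `t`-part of the affine metric. -/
theorem sum_logE_mul_logE (s s' : EuclideanSpace ℝ (Fin k)) :
    ∑ a, (n a + 1 : ℝ) * (logE n a s * logE n a s') =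
      ∑ l : Fin k, f n l.succ / ((n l.succ + 1) * f n l.castSucc) * (s l * s' l) := by
  have h : ∀ a, (n a + 1 : ℝ) * (logE n a s * logE n a s') = ∑ l, ∑ m,
      (n a + 1 : ℝ) * (logCoeff n a l * logCoeff n a m) * (s l * s' m) := by
    intro a
    rw [logE_apply, logE_apply, Finset.sum_mul_sum, Finset.mul_sum]
    refine Finset.sum_congr rfl fun l _ => ?_
    rw [Finset.mul_sum]
    refine Finset.sum_congr rfl fun m _ => ?_
    ring
  simp only [h]
  rw [Finset.sum_comm]
  refine Finset.sum_congr rfl fun l _ => ?_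
  rw [Finset.sum_comm]
  rw [Finset.sum_eq_single l]
  · rw [← Finset.sum_mul, sum_logCoeff_sq]
  · intro m _ hm
    rw [← Finset.sum_mul]
    rcases lt_or_gt_of_ne hm with h | h
    · have := sum_logCoeff_mul_of_lt n h
      simp only [mul_comm (logCoeff n _ m)] at this
      rw [this, zero_mul]
    · rw [sum_logCoeff_mul_of_lt n h, zero_mul]
  · simp

theorem e_pos (a : Fin (k + 1)) (t : EuclideanSpace ℝ (Fin k)) : 0 < e n a t := Real.exp_pos _

theorem prod_e_pow (t : EuclideanSpace ℝ (Fin k)) : ∏ a, e n a t ^ (n a + 1) = 1 := by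
  have h : ∀ a, e n a t ^ (n a + 1) = Real.exp ((n a + 1 : ℝ) * logE n a t) := by
    intro a
    rw [e_eq_exp, ← Real.exp_nat_mul]
    push_cast
    rfl
  simp only [h]
  rw [← Real.exp_sum, sum_logE, Real.exp_zero]

theorem C_pos {L : Fin (k + 1) → ℝ} (hL : ∀ a, L a < 0) {c : Fin (k + 1) → ℝ} (hc : ∀ a, 0 < c a) :
    0 < C n L c := by
  unfold C
  have := f_pos n (Fin.last k)
  refine Real.rpow_pos_of_pos (mul_pos (inv_pos.2 this) (Finset.prod_pos fun a _ => ?_)) _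
  have h1 := hc a
  have h2 : 0 < -L a := neg_pos.2 (hL a)
  positivity

theorem C_pow {L : Fin (k + 1) → ℝ} (hL : ∀ a, L a < 0) {c : Fin (k + 1) → ℝ} (hc : ∀ a, 0 < c a) :
    C n L c ^ (f n (Fin.last k) + 1) = (f n (Fin.last k) : ℝ)⁻¹ *
      ∏ a, c a ^ (2 * (n a + 1)) / ((n a + 1 : ℝ) ^ (n a + 1) * (-L a) ^ (n a + 2)) := by
  unfold C
  rw [← Real.rpow_natCast, ← Real.rpow_mul]
  · rw [Nat.cast_add, Nat.cast_one, one_div_mul_cancel (by positivity), Real.rpow_one]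
  · have := f_pos n (Fin.last k)
    refine (mul_pos (inv_pos.2 this) (Finset.prod_pos fun a _ => ?_)).le
    have h1 := hc a
    have h2 : 0 < -L a := neg_pos.2 (hL a)
    positivity

/-- With the constant `C` the form obtained by rescaling the factors has the determinant
`1 / (f_K C)`, which is what the volume normalisation of the affine normal asks for. -/
theorem prod_scale {L : Fin (k + 1) → ℝ} (hL : ∀ a, L a < 0) {c : Fin (k + 1) → ℝ}
    (hc : ∀ a, 0 < c a) (t : EuclideanSpace ℝ (Fin k)) :
    ∏ a, (C n L c * (n a + 1) / (c a * e n a t) ^ 2) ^ (n a + 1) * (-L a) ^ (n a + 2) =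
      1 / (f n (Fin.last k) * C n L c) := by
  have hC := C_pos n hL hc
  have hf := f_pos n (Fin.last k)
  have h : ∀ a, (C n L c * (n a + 1) / (c a * e n a t) ^ 2) ^ (n a + 1) * (-L a) ^ (n a + 2) =
      C n L c ^ (n a + 1) / (c a ^ (2 * (n a + 1)) /
        ((n a + 1 : ℝ) ^ (n a + 1) * (-L a) ^ (n a + 2))) / (e n a t ^ (n a + 1)) ^ 2 := by
    intro a
    have h1 := (hc a).ne'
    have h2 : -L a ≠ 0 := (neg_pos.2 (hL a)).ne'
    have h3 := (e_pos n a t).ne'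
    rw [div_pow, mul_pow, ← pow_mul, ← pow_mul, mul_pow, mul_comm (n a + 1) 2]
    field_simp
  have hp : (∏ a, c a ^ (2 * (n a + 1)) / ((n a + 1 : ℝ) ^ (n a + 1) * (-L a) ^ (n a + 2))) =
      f n (Fin.last k) * C n L c ^ (f n (Fin.last k) + 1) := by
    rw [C_pow n hL hc]
    field_simp
  simp only [h, Finset.prod_div_distrib, Finset.prod_pow, prod_e_pow]
  rw [Finset.prod_div_distrib, Finset.prod_mul_distrib] at hp
  rw [Finset.prod_mul_distrib, hp, Finset.prod_pow_eq_pow_sum, ← f_last, pow_succ]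
  field_simp

end Calabi

/-! ### The Calabi composition in product charts -/

namespace Calabi

variable {k : ℕ} {n : Fin (k + 1) → ℕ}

theorem range_model : Set.range ((𝓡 k).prod (ModelWithCorners.pi fun a => 𝓡 (n a))) = Set.univ :=
  Set.range_eq_univ.2 fun y => ⟨y, rfl⟩

variable {M : Fin (k + 1) → Type*} [∀ a, TopologicalSpace (M a)]
  [∀ a, ChartedSpace (EuclideanSpace ℝ (Fin (n a))) (M a)]
  {x : ∀ a, M a → Fin (n a + 1) → ℝ} {c : Fin (k + 1) → ℝ}

/-- The composition in the product chart. The chart of `ℝ^k` is the identity, so that each factor is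
an exponential of a linear form times a coordinate of `x_a` in its own chart. -/
theorem composition_comp_chart_symm (q : EuclideanSpace ℝ (Fin k) × (∀ a, M a)) :
    composition n x c ∘
        (extChartAt ((𝓡 k).prod (ModelWithCorners.pi fun a => 𝓡 (n a))) q).symm =
      fun w i => c i.1 * Real.exp
        ((logE n i.1).comp (ContinuousLinearMap.fst ℝ (EuclideanSpace ℝ (Fin k))
          (∀ a, EuclideanSpace ℝ (Fin (n a)))) w) *
        x i.1 ((extChartAt (𝓡 (n i.1)) (q.2 i.1)).symm
          ((ContinuousLinearMap.proj (R := ℝ) (φ := fun a => EuclideanSpace ℝ (Fin (n a))) i.1).comp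
            (ContinuousLinearMap.snd ℝ (EuclideanSpace ℝ (Fin k)) _) w)) i.2 := by
  funext w i
  simp only [Function.comp_apply, composition, e_eq_exp]
  rfl

theorem chart_coord_contDiffAt
    (hx : ∀ a, ContMDiff (𝓡 (n a)) 𝓘(ℝ, Fin (n a + 1) → ℝ) ∞ (x a))
    (a : Fin (k + 1)) (p : M a) (j : Fin (n a + 1)) :
    ContDiffAt ℝ ∞ (fun u => x a ((extChartAt (𝓡 (n a)) p).symm u) j)
      (extChartAt (𝓡 (n a)) p p) :=
  contDiffAt_pi.1 ((contMDiffAt_iff_contDiffAt_chart (by simp)).1 (hx a p)).2 j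

theorem composition_contMDiff
    (hx : ∀ a, ContMDiff (𝓡 (n a)) 𝓘(ℝ, Fin (n a + 1) → ℝ) ∞ (x a)) :
    ContMDiff ((𝓡 k).prod (ModelWithCorners.pi fun a => 𝓡 (n a)))
      𝓘(ℝ, (Σ a : Fin (k + 1), Fin (n a + 1)) → ℝ) ∞ (composition n x c) := by
  intro q
  refine (contMDiffAt_iff_contDiffAt_chart range_model).2 ⟨?_, ?_⟩
  · refine Continuous.continuousAt (continuous_pi fun i => ?_)
    simp only [composition, e_eq_exp]
    have h := (hx i.1).continuous
    fun_prop
  · rw [composition_comp_chart_symm, contDiffAt_pi]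
    intro i
    have h := chart_coord_contDiffAt hx i.1 (q.2 i.1) i.2
    refine ContDiffAt.mul (contDiffAt_const.mul (ContinuousLinearMap.contDiff _).contDiffAt.exp) ?_
    exact ContDiffAt.comp (g := fun u => x i.1 ((extChartAt (𝓡 (n i.1)) (q.2 i.1)).symm u) i.2)
      _ h (ContinuousLinearMap.contDiff _).contDiffAt

/-- The component in the factor `a` of the differential of the composition. -/
theorem differential_composition
    (hx : ∀ a, ContMDiff (𝓡 (n a)) 𝓘(ℝ, Fin (n a + 1) → ℝ) ∞ (x a))
    (q : EuclideanSpace ℝ (Fin k) × (∀ a, M a)) (s : EuclideanSpace ℝ (Fin k))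
    (v : ∀ a, TangentSpace (𝓡 (n a)) (q.2 a)) (a : Fin (k + 1)) :
    (fun j => differential ((𝓡 k).prod (ModelWithCorners.pi fun a => 𝓡 (n a)))
      (composition n x c) q (s, v) ⟨a, j⟩) = (c a * e n a q.1) •
        (logE n a s • x a (q.2 a) + differential (𝓡 (n a)) (x a) (q.2 a) (v a)) := by
  funext j
  have hX := composition_contMDiff (c := c) hx q
  have hX' := ((contMDiffAt_iff_contDiffAt_chart range_model).1 hX).2
  have hy := chart_coord_contDiffAt hx a (q.2 a) j
  refine (congrFun (differential_eq_fderiv range_model hX (s, v)) ⟨a, j⟩).trans ?_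
  refine (fderiv_apply_coord (hX'.differentiableAt (by simp)) _ _).trans ?_
  have h := (hasFDerivAt_exp_mul_comp (c a)
    ((logE n a).comp (ContinuousLinearMap.fst ℝ (EuclideanSpace ℝ (Fin k))
          (∀ a, EuclideanSpace ℝ (Fin (n a)))))
    ((ContinuousLinearMap.proj (R := ℝ) (φ := fun a => EuclideanSpace ℝ (Fin (n a))) a).comp
            (ContinuousLinearMap.snd ℝ (EuclideanSpace ℝ (Fin k)) _))
    (w := extChartAt ((𝓡 k).prod (ModelWithCorners.pi fun a => 𝓡 (n a))) q q)
    (y := fun u => x a ((extChartAt (𝓡 (n a)) (q.2 a)).symm u) j)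
    (hy.differentiableAt (by simp))).fderiv
  have hd : differential (𝓡 (n a)) (x a) (q.2 a) (v a) j =
      fderiv ℝ (fun u => x a ((extChartAt (𝓡 (n a)) (q.2 a)).symm u) j)
        (extChartAt (𝓡 (n a)) (q.2 a) (q.2 a)) (v a) := by
    rw [differential_eq_fderiv (by simp) (hx a (q.2 a))]
    exact fderiv_apply_coord (((contMDiffAt_iff_contDiffAt_chart (by simp)).1
      (hx a (q.2 a))).2.differentiableAt (by simp)) _ _
  have hx0 : x a (q.2 a) j =
      x a ((extChartAt (𝓡 (n a)) (q.2 a)).symm (extChartAt (𝓡 (n a)) (q.2 a) (q.2 a))) j := by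
    rw [extChartAt_to_inv]
  simp only [Pi.smul_apply, Pi.add_apply, smul_eq_mul]
  rw [hd, e_eq_exp, hx0, mul_comm (logE n a s)]
  have h2 := composition_comp_chart_symm (x := x) (c := c) q
  refine (congrArg (fun T => fderiv ℝ (fun w => T w ⟨a, j⟩) _ _) h2).trans ?_
  exact congrArg (fun T => T (s, v)) h

/-- The component in the factor `a` of the second derivative of the composition. -/
theorem chartHessian_composition
    (hx : ∀ a, ContMDiff (𝓡 (n a)) 𝓘(ℝ, Fin (n a + 1) → ℝ) ∞ (x a))
    (q : EuclideanSpace ℝ (Fin k) × (∀ a, M a)) (s s' : EuclideanSpace ℝ (Fin k))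
    (v v' : ∀ a, TangentSpace (𝓡 (n a)) (q.2 a)) (a : Fin (k + 1)) :
    (fun j => chartHessian ((𝓡 k).prod (ModelWithCorners.pi fun a => 𝓡 (n a)))
      (composition n x c) q (s, v) (s', v') ⟨a, j⟩) = (c a * e n a q.1) •
        ((logE n a s * logE n a s') • x a (q.2 a) +
          logE n a s • differential (𝓡 (n a)) (x a) (q.2 a) (v' a) +
          logE n a s' • differential (𝓡 (n a)) (x a) (q.2 a) (v a) +
          chartHessian (𝓡 (n a)) (x a) (q.2 a) (v a) (v' a)) := by
  funext j
  have hX' := ((contMDiffAt_iff_contDiffAt_chart range_model).1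
    (composition_contMDiff (c := c) hx q)).2
  have hxa := ((contMDiffAt_iff_contDiffAt_chart (by simp)).1 (hx a (q.2 a))).2
  have hy := chart_coord_contDiffAt hx a (q.2 a) j
  refine (fderiv_fderiv_apply_coord hX' _ _ _).trans ?_
  have h := fderiv_fderiv_exp_mul_comp (c a)
    ((logE n a).comp (ContinuousLinearMap.fst ℝ (EuclideanSpace ℝ (Fin k))
          (∀ a, EuclideanSpace ℝ (Fin (n a)))))
    ((ContinuousLinearMap.proj (R := ℝ) (φ := fun a => EuclideanSpace ℝ (Fin (n a))) a).comp
            (ContinuousLinearMap.snd ℝ (EuclideanSpace ℝ (Fin k)) _))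
    (w := extChartAt ((𝓡 k).prod (ModelWithCorners.pi fun a => 𝓡 (n a))) q q)
    (y := fun u => x a ((extChartAt (𝓡 (n a)) (q.2 a)).symm u) j) hy (s, v) (s', v')
  have hd : ∀ u : TangentSpace (𝓡 (n a)) (q.2 a),
      differential (𝓡 (n a)) (x a) (q.2 a) u j =
      fderiv ℝ (fun u => x a ((extChartAt (𝓡 (n a)) (q.2 a)).symm u) j)
        (extChartAt (𝓡 (n a)) (q.2 a) (q.2 a)) u := by
    intro u
    rw [differential_eq_fderiv (by simp) (hx a (q.2 a))]
    exact fderiv_apply_coord (hxa.differentiableAt (by simp)) _ _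
  have hh : chartHessian (𝓡 (n a)) (x a) (q.2 a) (v a) (v' a) j =
      fderiv ℝ (fderiv ℝ fun u => x a ((extChartAt (𝓡 (n a)) (q.2 a)).symm u) j)
        (extChartAt (𝓡 (n a)) (q.2 a) (q.2 a)) (v a) (v' a) :=
    fderiv_fderiv_apply_coord hxa _ _ _
  have hx0 : x a (q.2 a) j =
      x a ((extChartAt (𝓡 (n a)) (q.2 a)).symm (extChartAt (𝓡 (n a)) (q.2 a) (q.2 a))) j := by
    rw [extChartAt_to_inv]
  simp only [Pi.smul_apply, Pi.add_apply, smul_eq_mul]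
  rw [hd, hd, hh, e_eq_exp, hx0]
  have h2 := composition_comp_chart_symm (x := x) (c := c) q
  refine (congrArg (fun T => fderiv ℝ (fderiv ℝ (fun w => T w ⟨a, j⟩)) _ _ _) h2).trans ?_
  exact h

end Calabi

/-! ### The affine metric of the composition -/

namespace Calabi

variable {k : ℕ} {n : Fin (k + 1) → ℕ}

section Metric

variable {V : Fin (k + 1) → Type*} [∀ a, AddCommGroup (V a)] [∀ a, Module ℝ (V a)]

/-- The form `∑ d_l (dt_l)² + ∑ w_a g_a` on `ℝ^k × ∏ V_a`. -/
noncomputable def productForm (d : Fin k → ℝ) (w : Fin (k + 1) → ℝ)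
    (g : ∀ a, LinearMap.BilinForm ℝ (V a)) :
    LinearMap.BilinForm ℝ (EuclideanSpace ℝ (Fin k) × (∀ a, V a)) :=
  LinearMap.mk₂ ℝ (fun u u' => ∑ l, d l * (u.1 l * u'.1 l) + ∑ a, w a * g a (u.2 a) (u'.2 a))
    (fun u₁ u₂ u' => by
      simp only [Prod.fst_add, Prod.snd_add, PiLp.add_apply, Pi.add_apply, map_add,
        LinearMap.add_apply, add_mul, mul_add, Finset.sum_add_distrib]
      ring)
    (fun r u u' => by
      simp only [Prod.smul_fst, Prod.smul_snd, PiLp.smul_apply, Pi.smul_apply, map_smul,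
        LinearMap.smul_apply, smul_eq_mul, mul_add, Finset.mul_sum]
      congr 1 <;> exact Finset.sum_congr rfl fun _ _ => by ring)
    (fun u u₁ u₂ => by
      simp only [Prod.fst_add, Prod.snd_add, PiLp.add_apply, Pi.add_apply, map_add,
        mul_add, Finset.sum_add_distrib]
      ring)
    (fun r u u' => by
      simp only [Prod.smul_fst, Prod.smul_snd, PiLp.smul_apply, Pi.smul_apply, map_smul,
        smul_eq_mul, mul_add, Finset.mul_sum]
      congr 1 <;> exact Finset.sum_congr rfl fun _ _ => by ring)

theorem productForm_apply (d : Fin k → ℝ) (w : Fin (k + 1) → ℝ)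
    (g : ∀ a, LinearMap.BilinForm ℝ (V a)) (s s' : EuclideanSpace ℝ (Fin k)) (v v' : ∀ a, V a) :
    productForm d w g (s, v) (s', v') =
      ∑ l, d l * (s l * s' l) + ∑ a, w a * g a (v a) (v' a) := rfl

theorem productForm_nondegenerate {d : Fin k → ℝ} {w : Fin (k + 1) → ℝ}
    {g : ∀ a, LinearMap.BilinForm ℝ (V a)} (hd : ∀ l, d l ≠ 0) (hw : ∀ a, w a ≠ 0)
    (hg : ∀ a, (g a).Nondegenerate) : (productForm d w g).Nondegenerate := by
  have hsingle : ∀ (a : Fin (k + 1)) (u : V a) (y : ∀ b, V b),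
      ∑ b, w b * g b (y b) (Pi.single a u b) = w a * g a (y a) u ∧
      ∑ b, w b * g b (Pi.single a u b) (y b) = w a * g a u (y a) := by
    intro a u y
    constructor
    · rw [Finset.sum_eq_single a (fun b _ hb => by simp [Pi.single_eq_of_ne hb]) (by simp)]
      simp
    · rw [Finset.sum_eq_single a (fun b _ hb => by simp [Pi.single_eq_of_ne hb]) (by simp)]
      simp
  constructor
  · rintro ⟨s, v⟩ h
    have hs : s = 0 := by
      ext l
      simpa [productForm_apply, hd l] using h (EuclideanSpace.single l 1, 0)
    have hv : v = 0 := by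
      funext a
      refine (hg a).1 _ fun u => ?_
      simpa [productForm_apply, (hsingle a u v).1, hw a] using h (0, Pi.single a u)
    rw [hs, hv, Prod.mk_zero_zero]
  · rintro ⟨s, v⟩ h
    have hs : s = 0 := by
      ext l
      simpa [productForm_apply, hd l] using h (EuclideanSpace.single l 1, 0)
    have hv : v = 0 := by
      funext a
      refine (hg a).2 _ fun u => ?_
      simpa [productForm_apply, (hsingle a u v).2, hw a] using h (0, Pi.single a u)
    rw [hs, hv, Prod.mk_zero_zero]

end Metric

/-! ### The composition is a hyperbolic affine hypersphere -/

section Composition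

variable {M : Fin (k + 1) → Type*} [∀ a, TopologicalSpace (M a)]
  [∀ a, ChartedSpace (EuclideanSpace ℝ (Fin (n a))) (M a)]
  {x : ∀ a, M a → Fin (n a + 1) → ℝ}
  {g : ∀ a, ∀ p : M a, LinearMap.BilinForm ℝ (TangentSpace (𝓡 (n a)) p)}
  {ξ : ∀ a, M a → Fin (n a + 1) → ℝ} {L : Fin (k + 1) → ℝ} {c : Fin (k + 1) → ℝ}

/-- The ambient form of the composition is block diagonal; the weights of the blocks make the
position vector of the composition orthogonal to its tangent space, because
`∑ (n_a + 1) log e_a = 0`. -/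
theorem exists_matrix_composition
    (hx : ∀ a, IsHyperbolicAffineHypersphere (𝓡 (n a)) (x a) (g a) (ξ a) (L a))
    (hcenter : ∀ a, HasAffineCenter (x a) (ξ a) 0) (hc : ∀ a, 0 < c a)
    (q : EuclideanSpace ℝ (Fin k) × (∀ a, M a)) :
    ∃ S : Matrix (Σ a : Fin (k + 1), Fin (n a + 1)) (Σ a : Fin (k + 1), Fin (n a + 1)) ℝ,
      |S.det| = 1 / (f n (Fin.last k) * C n L c) ∧
      ∀ (Y Y' : (Σ a : Fin (k + 1), Fin (n a + 1)) → ℝ) (r r' : Fin (k + 1) → ℝ)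
        (v v' : ∀ a, TangentSpace (𝓡 (n a)) (q.2 a)),
        (∀ a, (fun j => Y ⟨a, j⟩) = (c a * e n a q.1) •
          (r a • x a (q.2 a) + differential (𝓡 (n a)) (x a) (q.2 a) (v a))) →
        (∀ a, (fun j => Y' ⟨a, j⟩) = (c a * e n a q.1) •
          (r' a • x a (q.2 a) + differential (𝓡 (n a)) (x a) (q.2 a) (v' a))) →
        Matrix.toLinearMap₂' ℝ S Y Y' =
          ∑ a, C n L c * (n a + 1) * (r a * r' a + -L a * g a (q.2 a) (v a) (v' a)) := by
  have hL : ∀ a, L a < 0 := fun a => (hx a).neg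
  have hC := C_pos n hL hc
  choose S hS hdet using fun a => (hx a).exists_matrix (by simp) (hcenter a) (q.2 a)
  refine ⟨Matrix.blockDiagonal' fun a =>
    (C n L c * (n a + 1) / (c a * e n a q.1) ^ 2) • S a, ?_, ?_⟩
  · rw [det_blockDiagonal_sigma, Finset.abs_prod, ← prod_scale n hL hc q.1]
    refine Finset.prod_congr rfl fun a _ => ?_
    rw [Matrix.det_smul, abs_mul, hdet, Fintype.card_fin, finrank_euclideanSpace_fin, abs_of_nonneg]
    positivity
  · intro Y Y' r r' v v' hY hY'
    rw [toLinearMap₂'_blockDiagonal]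
    refine Finset.sum_congr rfl fun a _ => ?_
    have h1 := (hc a).ne'
    have h2 := (e_pos n a q.1).ne'
    simp only [hY, hY', map_smul, LinearMap.smul_apply, hS, smul_eq_mul]
    field_simp

theorem isHyperbolicAffineHypersphere_composition (hk : 1 ≤ k)
    (hx : ∀ a, IsHyperbolicAffineHypersphere (𝓡 (n a)) (x a) (g a) (ξ a) (L a))
    (hcenter : ∀ a, HasAffineCenter (x a) (ξ a) 0) (hc : ∀ a, 0 < c a) :
    IsHyperbolicAffineHypersphere ((𝓡 k).prod (ModelWithCorners.pi fun a => 𝓡 (n a)))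
        (composition n x c)
        (fun q => productForm (fun l => f n l.succ * C n L c / ((n l.succ + 1) * f n l.castSucc))
          (fun a => (n a + 1) * (-L a) * C n L c) fun a => g a (q.2 a))
        (fun q => (- -(1 / (f n (Fin.last k) * C n L c))) • composition n x c q)
        (-(1 / (f n (Fin.last k) * C n L c))) ∧
      HasAffineCenter (composition n x c)
        (fun q => (- -(1 / (f n (Fin.last k) * C n L c))) • composition n x c q) 0 := by
  have hL : ∀ a, L a < 0 := fun a => (hx a).neg
  have hC := C_pos n hL hc
  have hf := f_pos n
  have hsm : ∀ a, ContMDiff (𝓡 (n a)) 𝓘(ℝ, Fin (n a + 1) → ℝ) ∞ (x a) := fun a => by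
    obtain ⟨B, hB, -⟩ := (hx a).exists_shape
    exact hB.smooth
  have hdpos : ∀ l : Fin k,
      0 < f n l.succ * C n L c / ((n l.succ + 1) * f n l.castSucc) := fun l => by
    have := hf l.succ
    have := hf l.castSucc
    positivity
  choose S hSdet hS using fun q : EuclideanSpace ℝ (Fin k) × (∀ a, M a) =>
    exists_matrix_composition hx hcenter hc q
  have hX : ∀ (q : EuclideanSpace ℝ (Fin k) × (∀ a, M a)) a,
      (fun j => composition n x c q ⟨a, j⟩) = (c a * e n a q.1) • ((1 : ℝ) • x a (q.2 a) +
        differential (𝓡 (n a)) (x a) (q.2 a) 0) := by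
    intro q a
    rw [map_zero, add_zero, one_smul]
    rfl
  -- The value of `productForm` in terms of the blocks.
  have hform : ∀ (q : EuclideanSpace ℝ (Fin k) × (∀ a, M a)) (s s' : EuclideanSpace ℝ (Fin k))
      (v v' : ∀ a, TangentSpace (𝓡 (n a)) (q.2 a)),
      ∑ a, C n L c * (n a + 1) * (logE n a s * logE n a s' + -L a * g a (q.2 a) (v a) (v' a)) =
      ∑ l : Fin k, f n l.succ * C n L c / ((n l.succ + 1) * f n l.castSucc) * (s l * s' l) +
        ∑ a, (n a + 1) * (-L a) * C n L c * g a (q.2 a) (v a) (v' a) := by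
    intro q s s' v v'
    have h1 : ∑ l : Fin k, f n l.succ * C n L c / ((n l.succ + 1) * f n l.castSucc) *
        (s l * s' l) = C n L c * ∑ a, (n a + 1 : ℝ) * (logE n a s * logE n a s') := by
      rw [sum_logE_mul_logE, Finset.mul_sum]
      refine Finset.sum_congr rfl fun l _ => ?_
      ring
    rw [h1, Finset.mul_sum, ← Finset.sum_add_distrib]
    refine Finset.sum_congr rfl fun a _ => ?_
    ring
  have hlog : ∀ s, ∑ a, C n L c * (n a + 1 : ℝ) * logE n a s = 0 := fun s => by
    simp only [mul_assoc, ← Finset.mul_sum, sum_logE, mul_zero]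
  refine isHyperbolicAffineHypersphere_of_matrix range_model ?_ ?_ (composition_contMDiff hsm) ?_ ?_
    S ?_ ?_ ?_ ?_ ?_ ?_
  · have := hf (Fin.last k)
    rw [neg_lt_zero]
    positivity
  · simp [Module.finrank_prod, Module.finrank_pi_fintype, Finset.sum_add_distrib]
    ring
  · intro q
    refine productForm_nondegenerate (fun l => (hdpos l).ne') (fun a => ?_) fun a => ?_
    · have := neg_pos.2 (hL a)
      positivity
    · obtain ⟨B, hB, -⟩ := (hx a).exists_shape
      exact hB.nondegenerate (q.2 a)
  -- As `1 ≤ k`, there is a direction `∂/∂t_0`, on which the metric is positive.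
  · intro q
    refine ⟨(EuclideanSpace.single ⟨0, hk⟩ 1, 0), ?_⟩
    refine lt_of_lt_of_eq (hdpos ⟨0, hk⟩)
      ((productForm_apply _ _ (fun a => g a (q.2 a)) _ _ 0 0).trans ?_).symm
    simp
  · intro q
    rw [hSdet, neg_neg]
  · rintro q ⟨s, (v : ∀ a, TangentSpace (𝓡 (n a)) (q.2 a))⟩
      ⟨s', (v' : ∀ a, TangentSpace (𝓡 (n a)) (q.2 a))⟩
    exact (hS q _ _ _ _ v v' (differential_composition hsm q s v)
      (differential_composition hsm q s' v')).trans (hform q s s' v v')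
  · rintro q ⟨s, (v : ∀ a, TangentSpace (𝓡 (n a)) (q.2 a))⟩
    refine (hS q _ _ _ (fun _ => 1) v (fun _ => 0) (differential_composition hsm q s v)
      (hX q)).trans ?_
    simp [hlog]
  · rintro q ⟨s, (v : ∀ a, TangentSpace (𝓡 (n a)) (q.2 a))⟩
    refine (hS q _ _ (fun _ => 1) _ (fun _ => 0) v (hX q)
      (differential_composition hsm q s v)).trans ?_
    simp [hlog]
  · intro q
    refine (hS q _ _ (fun _ => 1) (fun _ => 1) (fun _ => 0) (fun _ => 0) (hX q) (hX q)).trans ?_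
    simp only [map_zero, mul_zero, add_zero, mul_one, ← Finset.mul_sum, ← cast_f_last]
    field_simp
  · rintro q ⟨s, (v : ∀ a, TangentSpace (𝓡 (n a)) (q.2 a))⟩
      ⟨s', (v' : ∀ a, TangentSpace (𝓡 (n a)) (q.2 a))⟩
    -- The mixed terms `α_a(s) dx_a(v'_a)` of the second derivative are tangential in the factor `a`,
    -- so they are orthogonal to the position vector and do not contribute.
    have hgauss : ∀ a, ∃ z : TangentSpace (𝓡 (n a)) (q.2 a),
        chartHessian (𝓡 (n a)) (x a) (q.2 a) (v a) (v' a) =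
          differential (𝓡 (n a)) (x a) (q.2 a) z +
            (-L a * g a (q.2 a) (v a) (v' a)) • x a (q.2 a) := by
      intro a
      obtain ⟨B, hB, -⟩ := (hx a).exists_shape
      obtain ⟨z, hz⟩ := hB.gauss (q.2 a) (v a) (v' a)
      refine ⟨z, ?_⟩
      rw [hz, normal_eq_neg_smul (by simp) (hx a) (hcenter a), smul_smul, mul_comm (-L a)]
    choose z hz using hgauss
    refine (hS q _ _
      (fun a => logE n a s * logE n a s' + -L a * g a (q.2 a) (v a) (v' a)) (fun _ => 1)
      (fun a => logE n a s • v' a + logE n a s' • v a + z a) (fun _ => 0)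
      (fun a => ?_) (hX q)).trans ?_
    · refine (chartHessian_composition hsm q s s' v v' a).trans ?_
      rw [hz, map_add, map_add, map_smul, map_smul, add_smul]
      congr 1
      abel
    · simp only [map_zero, mul_zero, add_zero, mul_one]
      exact hform q s s' v v'

end Composition

/-! ### Equiaffine equivalence of the compositions -/

/-- Compositions whose constants have the same weighted product differ by the diagonal
transformation that rescales the factors. -/
theorem equiaffineEquivalent_composition {M : Fin (k + 1) → Type*}
    {x : ∀ a, M a → Fin (n a + 1) → ℝ} {c c' : Fin (k + 1) → ℝ} (hc : ∀ a, 0 < c a)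
    (hc' : ∀ a, 0 < c' a) (h : ∏ a, c a ^ (n a + 1) = ∏ a, c' a ^ (n a + 1)) :
    EquiaffineEquivalent (composition n x c) (composition n x c') := by
  have hne : ∀ a, c' a / c a ≠ 0 := fun a => (div_pos (hc' a) (hc a)).ne'
  let T : ((Σ a : Fin (k + 1), Fin (n a + 1)) → ℝ) ≃ₗ[ℝ] (Σ a : Fin (k + 1), Fin (n a + 1)) → ℝ :=
    LinearEquiv.piCongrRight fun i => LinearEquiv.smulOfNeZero ℝ ℝ (c' i.1 / c i.1) (hne i.1)
  have hT : ∀ y i, T y i = c' i.1 / c i.1 * y i := fun y i => rfl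
  refine ⟨T.toAffineEquiv, ?_, fun q => ?_⟩
  · have hlin : ((T.toAffineEquiv.linear : ((Σ a : Fin (k + 1), Fin (n a + 1)) → ℝ) →ₗ[ℝ] _)) =
        Matrix.toLin' (Matrix.diagonal fun i : Σ a : Fin (k + 1), Fin (n a + 1) =>
          c' i.1 / c i.1) := by
      refine LinearMap.ext fun y => funext fun i => ?_
      rw [Matrix.toLin'_apply, Matrix.mulVec_diagonal]
      rfl
    rw [hlin, LinearMap.det_toLin', Matrix.det_diagonal, Fintype.prod_sigma]
    have hp : ∏ a, c a ^ (n a + 1) ≠ 0 := (Finset.prod_pos fun a _ => pow_pos (hc a) _).ne'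
    simp only [Finset.prod_const, Finset.card_univ, Fintype.card_fin, div_pow,
      Finset.prod_div_distrib]
    rw [← h, div_self hp]
  · funext i
    have := (hc i.1).ne'
    change _ = c' i.1 / c i.1 * composition n x c q i
    simp only [composition]
    field_simp

end Calabi

theorem mainTheorem2 {k : ℕ} (hk : 1 ≤ k) (n : Fin (k + 1) → ℕ) (hn : ∀ a, 1 ≤ n a)
    (M : Fin (k + 1) → Type*) [∀ a, TopologicalSpace (M a)]
    [∀ a, ChartedSpace (EuclideanSpace ℝ (Fin (n a))) (M a)]
    [∀ a, IsManifold (𝓡 (n a)) ∞ (M a)]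
    (x : ∀ a, M a → Fin (n a + 1) → ℝ)
    (g : ∀ a, ∀ p : M a, LinearMap.BilinForm ℝ (TangentSpace (𝓡 (n a)) p))
    (ξ : ∀ a, M a → Fin (n a + 1) → ℝ) (L : Fin (k + 1) → ℝ)
    (hx : ∀ a, IsHyperbolicAffineHypersphere (𝓡 (n a)) (x a) (g a) (ξ a) (L a))
    (hcenter : ∀ a, HasAffineCenter (x a) (ξ a) 0) :
    (∀ c : Fin (k + 1) → ℝ, (∀ a, 0 < c a) →
      ∃ (G : ∀ q : EuclideanSpace ℝ (Fin k) × (∀ a, M a), LinearMap.BilinForm ℝ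
          (TangentSpace ((𝓡 k).prod (ModelWithCorners.pi fun a => 𝓡 (n a))) q))
        (Ξ : EuclideanSpace ℝ (Fin k) × (∀ a, M a) → (Σ a : Fin (k + 1), Fin (n a + 1)) → ℝ),
        IsHyperbolicAffineHypersphere ((𝓡 k).prod (ModelWithCorners.pi fun a => 𝓡 (n a)))
          (Calabi.composition n x c) G Ξ
          (-(1 / (Calabi.f n (Fin.last k) * Calabi.C n L c))) ∧
        HasAffineCenter (Calabi.composition n x c) Ξ 0 ∧
        ∀ (q : EuclideanSpace ℝ (Fin k) × (∀ a, M a)) (s s' : EuclideanSpace ℝ (Fin k))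
          (v v' : ∀ a, TangentSpace (𝓡 (n a)) (q.2 a)),
          G q (s, v) (s', v') =
            (∑ l : Fin k, (Calabi.f n l.succ * Calabi.C n L c /
              ((n l.succ + 1) * Calabi.f n l.castSucc)) * (s l * s' l)) +
            ∑ a, (n a + 1) * (-L a) * Calabi.C n L c * g a (q.2 a) (v a) (v' a)) ∧
    (∀ c : Fin (k + 1) → ℝ, (∀ a, 0 < c a) →
      ∃ c₁ c₂ : ℝ, 0 < c₁ ∧ 0 < c₂ ∧
        EquiaffineEquivalent (Calabi.composition n x c) (Calabi.composition n x fun _ => c₁) ∧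
        EquiaffineEquivalent (Calabi.composition n x c)
          (Calabi.composition n x (Function.update 1 (Fin.last k) c₂)) ∧
        EquiaffineEquivalent (Calabi.composition n x fun _ => c₁)
          (Calabi.composition n x (Function.update 1 (Fin.last k) c₂))) := by
  constructor
  · intro c hc
    obtain ⟨h, h'⟩ := Calabi.isHyperbolicAffineHypersphere_composition hk hx hcenter hc
    exact ⟨_, _, h, h', fun q =>
      Calabi.productForm_apply _ _ fun a => g a (q.2 a)⟩
  · intro c hc
    set P : ℝ := ∏ a, c a ^ (n a + 1) with hP
    have hP0 : 0 < P := Finset.prod_pos fun a _ => pow_pos (hc a) _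
    have hroot : ∀ m : ℕ, m ≠ 0 → (P ^ (m : ℝ)⁻¹) ^ m = P := fun m hm =>
      Real.rpow_inv_natCast_pow hP0.le hm
    have hf : Calabi.f n (Fin.last k) ≠ 0 := by
      have := Calabi.f_pos n (Fin.last k)
      exact_mod_cast this.ne'
    -- The constants are the roots that make the weighted products of all three maps equal to `P`.
    set c₁ : ℝ := P ^ (Calabi.f n (Fin.last k) : ℝ)⁻¹ with hc₁
    set c₂ : ℝ := P ^ ((n (Fin.last k) + 1 : ℕ) : ℝ)⁻¹ with hc₂
    have hc₁0 : 0 < c₁ := Real.rpow_pos_of_pos hP0 _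
    have hc₂0 : 0 < c₂ := Real.rpow_pos_of_pos hP0 _
    have hu0 : ∀ a, 0 < (Function.update 1 (Fin.last k) c₂ : Fin (k + 1) → ℝ) a := by
      intro a
      rcases eq_or_ne a (Fin.last k) with rfl | ha
      · simpa using hc₂0
      · simp [Function.update_of_ne ha]
    have h1 : ∏ a, c₁ ^ (n a + 1) = P := by
      rw [Finset.prod_pow_eq_pow_sum, ← Calabi.f_last, hroot _ hf]
    have h2 : ∏ a, (Function.update 1 (Fin.last k) c₂ : Fin (k + 1) → ℝ) a ^ (n a + 1) = P := by
      rw [Finset.prod_eq_single (Fin.last k)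
        (fun a _ ha => by simp [Function.update_of_ne ha]) (by simp), Function.update_self,
        hroot _ (Nat.succ_ne_zero _)]
    exact ⟨c₁, c₂, hc₁0, hc₂0,
      Calabi.equiaffineEquivalent_composition hc (fun _ => hc₁0) h1.symm,
      Calabi.equiaffineEquivalent_composition hc hu0 h2.symm,
      Calabi.equiaffineEquivalent_composition (fun _ => hc₁0) hu0 (h1.trans h2.symm)⟩
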